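/- **Lemma 14.** For positive integers $k_1,\dots,k_r$ let $\mathbb{K}_r(k_1,\dots,k_r)$ be the continuant given by $\mathbb{K}_0=1$, $\mathbb{K}_1(k_1)=k_1$, $\mathbb{K}_r(k_1,\dots,k_r)=k_r\,\mathbb{K}_{r-1}(k_1,\dots,k_{r-1})-\mathbb{K}_{r-2}(k_1,\dots,k_{r-2})$ for $r\ge 2$. Let $\mathcal{T}=\{(x,y): 0<x,y\le 1,\ x+y>1\}$, let $T:\mathcal{T}\to\mathcal{T}$, $T(x,y)=\bigl(y,\bigl[\tfrac{1+x}{y}\bigr]y-x\bigr)$, let $\mathcal{T}(k)=\{(x,y)\in\mathcal{T}:\bigl[\tfrac{1+x}{y}\bigr]=k\}$ and $\mathcal{T}(k_1,\dots,k_r)=\mathcal{T}(k_1)\cap T^{-1}\mathcal{T}(k_2)\cap\dots\cap T^{-(r-1)}\mathcal{T}(k_r)$. For $r\ge 1$ let $\mathcal{A}_r^{\circ}(D,c_0,c_1)$ be the set of all tuples $(k_1,\dots,k_r)$ of positive integers such that $\mathcal{T}(k_1,\dots,k_r)\neq\varnothing$ and $$c_1\mathbb{K}_i(k_1,\dots,k_i)-c_0\mathbb{K}_{i-1}(k_2,\dots,k_i)\not\equiv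 c_0\pmod D\quad(1\le i\le r-1),$$ $$c_1\mathbb{K}_r(k_1,\dots,k_r)-c_0\mathbb{K}_{r-1}(k_2,\dots,k_r)\equiv c_0\pmod D.$$ Then $\mathcal{A}_r^{\circ}(3,1,0)=\mathcal{A}_r^{\circ}(3,2,0)$ for every $r\ge 1$; this set is empty for $r=1$, and for $r\ge2$ it consists exactly of the following tuples $\mathbf{k}$, with the following continuants $\mathbb{K}_r(\mathbf{k})$: - $r=2$: $(1,k_2)$ with $k_2\equiv 2\pmod 3$, $k_2\ge 2$, continuant $k_2-1$; $(2,2)$: $3$; $(3,2)$: $5$; $(4,2)$: $7$. - $r=3$: $(1,k_2,1)$ with $k_2\equiv 0\pmod 3$, $k_2\ge 3$: $k_2-2$; $(2,1,k_3)$ with $k_3\equiv 0\pmod 3$, $k_3\ge 6$: $k_3-2$; $(1,3,2)$, $(2,3,1)$: $3$; $(2,3,2)$: $8$; $(3,1,6)$: $9$; $(k_1,1,3)$ with $4\le k_1\le 8$: $2k_1-3$. - $r=4$: $(1,k_2,1,2)$ with $k_2\equiv 1\pmod 3$, $k_2\ge 7$: $k_2-3$; $(2,1,k_3,1)$ with $k_3\equiv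 1\pmod 3$, $k_3\ge 7$: $k_3-3$; $(1,4,1,3)$, $(3,1,4,1)$: $3$; $(1,4,1,4)$, $(4,1,4,1)$: $5$; $(1,4,1,5)$, $(5,1,4,1)$: $7$; $(2,4,1,3)$, $(3,1,4,2)$: $8$; $(1,7,1,3)$, $(3,1,7,1)$: $9$; $(2,4,1,4)$, $(4,1,4,2)$: $13$; $(k_1,1,2,3)$ with $7\le k_1\le 12$: $2k_1-5$. - $r=5$: $(2,1,k_3,1,2)$ with $k_3\equiv 2\pmod 3$, $k_3\ge 8$: $k_3-4$; $(k_1,1,2,2,3)$ with $10\le k_1\le 16$: $2k_1-7$; $(k_1,1,2,4,1)$ with $6\le k_1\le 8$: $2k_1-5$; $(1,4,2,1,k_5)$ with $6\le k_5\le 8$: $2k_5-5$; $(3,1,5,1,3)$: $8$; $(2,1,8,1,3)$, $(3,1,8,1,2)$: $9$; $(3,1,5,1,4)$, $(4,1,5,1,3)$: $13$. - $r\ge 6$: $(k_1,1,2^{r-3},3)$ with $4r-10\le k_1\le 4r-4$, where $2^{r-3}$ stands for $r-3$ components equal to $2$: $2k_1-2r+3$. -/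

import Mathlib

/-- The continuant `K_r(k₁, …, k_r)`, with `K_0 = 1` and `K_1(k₁) = k₁`, in the convention
of the minus sign: `K_r(k₁, …, k_r) = k₁ K_{r-1}(k₂, …, k_r) - K_{r-2}(k₃, …, k_r)`. -/
def continuant : List ℕ → ℤ
  | [] => 1
  | [a] => (a : ℤ)
  | a :: b :: l => (a : ℤ) * continuant (b :: l) - continuant l

/-- The same recursion from the other end:
`K_r(k₁, …, k_r) = k_r K_{r-1}(k₁, …, k_{r-1}) - K_{r-2}(k₁, …, k_{r-2})`. -/
theorem continuant_append_pair (a b : ℕ) : ∀ l : List ℕ,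
    continuant (l ++ [a, b]) = (b : ℤ) * continuant (l ++ [a]) - continuant l
  | [] => by simp only [List.nil_append, continuant]; ring
  | [c] => by simp only [List.cons_append, List.nil_append, continuant]; ring
  | c :: d :: l => by
    have h1 := continuant_append_pair a b (d :: l)
    have h2 := continuant_append_pair a b l
    simp only [List.cons_append, continuant] at h1 h2 ⊢
    rw [h1, h2]; ring

/-- The Farey triangle `0 < x, y ≤ 1`, `x + y > 1`. -/
def fareyTriangle : Set (ℝ × ℝ) :=
  {p | 0 < p.1 ∧ p.1 ≤ 1 ∧ 0 < p.2 ∧ p.2 ≤ 1 ∧ 1 < p.1 + p.2}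

/-- The BCZ transformation `T(x, y) = (y, [(1 + x) / y] y - x)`; it maps the Farey triangle
to itself, and only its values there matter. -/
noncomputable def bczMap (p : ℝ × ℝ) : ℝ × ℝ :=
  (p.2, (⌊(1 + p.1) / p.2⌋ : ℝ) * p.2 - p.1)

/-- The region `𝒯(k)`: the points of the Farey triangle with `[(1 + x) / y] = k`. -/
def bczCell (k : ℕ) : Set (ℝ × ℝ) :=
  {p | p ∈ fareyTriangle ∧ ⌊(1 + p.1) / p.2⌋ = (k : ℤ)}

/-- The region `𝒯(k₁, …, k_r) = 𝒯(k₁) ∩ T⁻¹ 𝒯(k₂) ∩ ⋯ ∩ T^{-(r-1)} 𝒯(k_r)`. -/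
def bczRegion (k : List ℕ) : Set (ℝ × ℝ) :=
  {p | p ∈ fareyTriangle ∧ ∀ (i : ℕ) (hi : i < k.length), bczMap^[i] p ∈ bczCell k[i]}

/-- The set `𝒜_r°(D, c₀, c₁)`, for `r ≥ 1`: the tuples `(k₁, …, k_r)` of positive integers with
`c₁ K_i(k₁, …, k_i) - c₀ K_{i-1}(k₂, …, k_i) ≢ c₀ (mod D)` for `1 ≤ i ≤ r - 1`,
`c₁ K_r(k₁, …, k_r) - c₀ K_{r-1}(k₂, …, k_r) ≡ c₀ (mod D)`,
and a non-empty region `𝒯(k₁, …, k_r)`. -/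
def tupleSet (r : ℕ) (D c₀ c₁ : ℤ) : Set (List ℕ) :=
  {k | k.length = r ∧ (∀ a ∈ k, 1 ≤ a) ∧
    (∀ i : ℕ, 1 ≤ i → i < r →
      ¬ (c₁ * continuant (k.take i) - c₀ * continuant (k.take i).tail ≡ c₀ [ZMOD D])) ∧
    (c₁ * continuant k - c₀ * continuant k.tail ≡ c₀ [ZMOD D]) ∧
    (bczRegion k).Nonempty}

/-- The table of tuples: `TupleTable r k v` says that the table lists, in a row of length `r`,
the tuple `k` with the continuant value `v`. There is no row with `r = 1`. -/
inductive TupleTable : ℕ → List ℕ → ℤ → Prop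
  | row2_1 (a : ℕ) (h : a ≡ 2 [MOD 3]) (h' : 2 ≤ a) : TupleTable 2 [1, a] ((a : ℤ) - 1)
  | row2_2 : TupleTable 2 [2, 2] 3
  | row2_3 : TupleTable 2 [3, 2] 5
  | row2_4 : TupleTable 2 [4, 2] 7
  | row3_1 (a : ℕ) (h : a ≡ 0 [MOD 3]) (h' : 3 ≤ a) : TupleTable 3 [1, a, 1] ((a : ℤ) - 2)
  | row3_2 (a : ℕ) (h : a ≡ 0 [MOD 3]) (h' : 6 ≤ a) : TupleTable 3 [2, 1, a] ((a : ℤ) - 2)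
  | row3_3a : TupleTable 3 [1, 3, 2] 3
  | row3_3b : TupleTable 3 [2, 3, 1] 3
  | row3_4 : TupleTable 3 [2, 3, 2] 8
  | row3_5 : TupleTable 3 [3, 1, 6] 9
  | row3_6 (a : ℕ) (h : 4 ≤ a) (h' : a ≤ 8) : TupleTable 3 [a, 1, 3] (2 * (a : ℤ) - 3)
  | row4_1 (a : ℕ) (h : a ≡ 1 [MOD 3]) (h' : 7 ≤ a) : TupleTable 4 [1, a, 1, 2] ((a : ℤ) - 3)
  | row4_2 (a : ℕ) (h : a ≡ 1 [MOD 3]) (h' : 7 ≤ a) : TupleTable 4 [2, 1, a, 1] ((a : ℤ) - 3)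
  | row4_3a : TupleTable 4 [1, 4, 1, 3] 3
  | row4_3b : TupleTable 4 [3, 1, 4, 1] 3
  | row4_4a : TupleTable 4 [1, 4, 1, 4] 5
  | row4_4b : TupleTable 4 [4, 1, 4, 1] 5
  | row4_5a : TupleTable 4 [1, 4, 1, 5] 7
  | row4_5b : TupleTable 4 [5, 1, 4, 1] 7
  | row4_6a : TupleTable 4 [2, 4, 1, 3] 8
  | row4_6b : TupleTable 4 [3, 1, 4, 2] 8
  | row4_7a : TupleTable 4 [1, 7, 1, 3] 9
  | row4_7b : TupleTable 4 [3, 1, 7, 1] 9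
  | row4_8a : TupleTable 4 [2, 4, 1, 4] 13
  | row4_8b : TupleTable 4 [4, 1, 4, 2] 13
  | row4_9 (a : ℕ) (h : 7 ≤ a) (h' : a ≤ 12) : TupleTable 4 [a, 1, 2, 3] (2 * (a : ℤ) - 5)
  | row5_1 (a : ℕ) (h : a ≡ 2 [MOD 3]) (h' : 8 ≤ a) :
      TupleTable 5 [2, 1, a, 1, 2] ((a : ℤ) - 4)
  | row5_2 (a : ℕ) (h : 10 ≤ a) (h' : a ≤ 16) : TupleTable 5 [a, 1, 2, 2, 3] (2 * (a : ℤ) - 7)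
  | row5_3 (a : ℕ) (h : 6 ≤ a) (h' : a ≤ 8) : TupleTable 5 [a, 1, 2, 4, 1] (2 * (a : ℤ) - 5)
  | row5_4 (a : ℕ) (h : 6 ≤ a) (h' : a ≤ 8) : TupleTable 5 [1, 4, 2, 1, a] (2 * (a : ℤ) - 5)
  | row5_5 : TupleTable 5 [3, 1, 5, 1, 3] 8
  | row5_6a : TupleTable 5 [2, 1, 8, 1, 3] 9
  | row5_6b : TupleTable 5 [3, 1, 8, 1, 2] 9
  | row5_7a : TupleTable 5 [3, 1, 5, 1, 4] 13
  | row5_7b : TupleTable 5 [4, 1, 5, 1, 3] 13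
  | row6 (r a : ℕ) (hr : 6 ≤ r) (h : 4 * r - 10 ≤ a) (h' : a ≤ 4 * r - 4) :
      TupleTable r ([a, 1] ++ List.replicate (r - 3) 2 ++ [3]) (2 * (a : ℤ) - 2 * (r : ℤ) + 3)

/-! Since c₁ = 0 and c₀ is a unit modulo 3, each congruence says that the continuant of a prefix of
(k₂, …, k_r) is ≡ -1 ≡ 2. Hence c₀ plays no role, and k₁ is restricted only by positivity and the
region being non-empty.

Arithmetic: consecutive continuants (c, p) modulo 3 form a finite automaton started at (1, 0). A
letter ≡ 2 hits at once, and a letter ≡ 0 leads to (0, 1), where any next letter hits. A letter ≡ 1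
leads to (1, 1), where letters ≡ 2 loop, 0 hits and 1 leads to (0, 1). So the tail is (a), (a, b),
(a, ms, b) or (a, ms, b, x) with prescribed residues and only the run ms of unbounded length
(`FirstHit.of_one_zero`).

Geometry: the floor condition amounts to the next pair lying in the triangle, so an index word is
realised exactly when a system of linear inequalities is solvable. Adjacent indices ≥ 2 include a 2,
the other being at most 4 (`Admissible.pair`), so a run of length ≥ 2 is all twos. Index 2 continues
an arithmetic progression, which makes such runs computable: they are preceded by 1 and end in 3,
and k₁ lies in an explicit interval (`Admissible.one_replicate_two_three`). Shorter runs reduce to a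
few forbidden patterns. Conversely, each row has an explicit point. -/

/-! ### Orbits of the BCZ map with prescribed indices -/

/-- The points `(x, y)` whose orbit has the index sequence `l`: all the successive pairs
produced by `z = k y - x` lie in the Farey triangle. -/
def Orbit : ℝ → ℝ → List ℕ → Prop
  | x, y, [] => (x, y) ∈ fareyTriangle
  | x, y, k :: l => (x, y) ∈ fareyTriangle ∧ Orbit y (k * y - x) l

theorem mem_fareyTriangle_iff {x y : ℝ} :
    (x, y) ∈ fareyTriangle ↔ 0 < x ∧ x ≤ 1 ∧ 0 < y ∧ y ≤ 1 ∧ 1 < x + y := Iff.rfl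

theorem Orbit.mem {x y : ℝ} : ∀ {l : List ℕ}, Orbit x y l → (x, y) ∈ fareyTriangle
  | [], h => h
  | _ :: _, h => h.1

theorem orbit_nil_iff {x y : ℝ} :
    Orbit x y [] ↔ 0 < x ∧ x ≤ 1 ∧ 0 < y ∧ y ≤ 1 ∧ 1 < x + y := Iff.rfl

theorem orbit_cons_iff {x y : ℝ} {k : ℕ} {l : List ℕ} :
    Orbit x y (k :: l) ↔ (0 < x ∧ x ≤ 1 ∧ 0 < y ∧ y ≤ 1 ∧ 1 < x + y) ∧
      ∃ z, x + z = k * y ∧ Orbit y z l := by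
  constructor
  · rintro ⟨h, h'⟩
    exact ⟨h, _, by ring, h'⟩
  · rintro ⟨h, z, hz, h'⟩
    obtain rfl : z = k * y - x := by linarith
    exact ⟨h, h'⟩

/-- With z = ky - x, the floor bounds k ≤ (1 + x)/y < k + 1 read z ≤ 1 and y + z > 1; positivity of
z then follows from y ≤ 1. -/
theorem mem_bczCell_iff {x y : ℝ} {k : ℕ} : (x, y) ∈ bczCell k ↔
    (x, y) ∈ fareyTriangle ∧ (y, k * y - x) ∈ fareyTriangle := by
  refine and_congr_right fun h => ?_
  obtain ⟨h1, h2, h3, h4, h5⟩ := h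
  simp only at h1 h2 h3 h4 h5
  simp only [Int.floor_eq_iff, mem_fareyTriangle_iff, le_div_iff₀ h3, div_lt_iff₀ h3]
  push_cast
  constructor
  · rintro ⟨h6, h7⟩
    exact ⟨h3, h4, by linarith, by linarith, by linarith⟩
  · rintro ⟨-, -, h6, h7, h8⟩
    exact ⟨by linarith, by linarith⟩

theorem bczMap_of_mem_bczCell {x y : ℝ} {k : ℕ} (h : (x, y) ∈ bczCell k) :
    bczMap (x, y) = (y, k * y - x) := by
  have h' := h.2
  simp only at h'
  simp [bczMap, h']

theorem mem_bczRegion_iff_orbit {l : List ℕ} :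
    ∀ {x y : ℝ}, (x, y) ∈ bczRegion l ↔ Orbit x y l := by
  induction l with
  | nil => intro x y; simp [bczRegion, Orbit]
  | cons k l ih =>
    intro x y
    constructor
    · rintro ⟨h, h'⟩
      have h0 : (x, y) ∈ bczCell k := h' 0 (by simp)
      refine ⟨h, ih.1 ⟨(mem_bczCell_iff.1 h0).2, fun i hi => ?_⟩⟩
      have := h' (i + 1) (by simpa using hi)
      rwa [Function.iterate_succ_apply, bczMap_of_mem_bczCell h0] at this
    · rintro ⟨h, h'⟩
      have h0 : (x, y) ∈ bczCell k := mem_bczCell_iff.2 ⟨h, h'.mem⟩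
      refine ⟨h, fun i hi => ?_⟩
      cases i with
      | zero => exact h0
      | succ i =>
        rw [Function.iterate_succ_apply, bczMap_of_mem_bczCell h0]
        exact (ih.2 h').2 i (by simpa using hi)

theorem orbit_of_append {l l' : List ℕ} :
    ∀ {x y : ℝ}, Orbit x y (l ++ l') → Orbit x y l := by
  induction l with
  | nil => intro x y h; exact h.mem
  | cons k l ih => intro x y h; exact ⟨h.1, ih h.2⟩

/-- The index sequences of orbits of the BCZ map. -/
def Admissible (l : List ℕ) : Prop := ∃ x y, Orbit x y l

theorem bczRegion_nonempty_iff {l : List ℕ} : (bczRegion l).Nonempty ↔ Admissible l := by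
  constructor
  · rintro ⟨⟨x, y⟩, h⟩
    exact ⟨x, y, mem_bczRegion_iff_orbit.1 h⟩
  · rintro ⟨x, y, h⟩
    exact ⟨(x, y), mem_bczRegion_iff_orbit.2 h⟩

theorem Admissible.of_append_left {l l' : List ℕ} (h : Admissible (l ++ l')) : Admissible l := by
  obtain ⟨x, y, h⟩ := h
  exact ⟨x, y, orbit_of_append h⟩

theorem Admissible.tail {k : ℕ} {l : List ℕ} (h : Admissible (k :: l)) : Admissible l := by
  obtain ⟨x, y, h⟩ := h
  exact ⟨_, _, h.2⟩

/-! ### Runs of the index two -/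

/-- Index 2 means z = 2y - x, so the orbit is an arithmetic progression of step y - x along the run.
-/
theorem Orbit.replicate_two {n : ℕ} : ∀ {x y : ℝ} {l : List ℕ},
    Orbit x y (List.replicate n 2 ++ l) → Orbit (x - n * (x - y)) (y - n * (x - y)) l := by
  induction n with
  | zero => intro x y l h; simpa using h
  | succ n ih =>
    intro x y l h
    rw [List.replicate_succ, List.cons_append] at h
    have := ih h.2
    push_cast at this ⊢
    convert this using 1 <;> ring

/-- For a non-increasing progression the intermediate conditions follow from x ≤ 1 and from the last
pair being in the triangle. -/
theorem orbit_replicate_two {n : ℕ} : ∀ {x y : ℝ} {l : List ℕ}, x ≤ 1 → y ≤ x →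
    Orbit (x - n * (x - y)) (y - n * (x - y)) l → Orbit x y (List.replicate n 2 ++ l) := by
  induction n with
  | zero => intro x y l _ _ h; simpa using h
  | succ n ih =>
    intro x y l hx hxy h
    obtain ⟨h1, h2, h3, h4, h5⟩ := mem_fareyTriangle_iff.1 h.mem
    have h0 : 0 ≤ (n : ℝ) * (x - y) := mul_nonneg n.cast_nonneg (by linarith)
    push_cast at h1 h2 h3 h4 h5 h
    rw [List.replicate_succ, List.cons_append]
    refine ⟨⟨?_, ?_, ?_, ?_, ?_⟩, ih (by linarith) (by push_cast; linarith) ?_⟩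
    · simp only; linarith
    · simp only; linarith
    · simp only; linarith
    · simp only; linarith
    · simp only; linarith
    · push_cast
      convert h using 1 <;> ring

/-! ### Forbidden patterns -/

theorem index_mul_le {c k : ℕ} {x y z : ℝ} (h : x + z = k * y) (hy : 0 < y) (hk : c ≤ k) :
    (c : ℝ) * y ≤ x + z :=
  h ▸ mul_le_mul_of_nonneg_right (Nat.cast_le.2 hk) hy.le

theorem le_index_mul {c k : ℕ} {x y z : ℝ} (h : x + z = k * y) (hy : 0 < y) (hk : k ≤ c) :
    x + z ≤ (c : ℝ) * y :=
  h ▸ mul_le_mul_of_nonneg_right (Nat.cast_le.2 hk) hy.le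

/-- Each exclusion combines the two recurrences linearly. For instance k, l ≥ 3 would give x + w ≥
2(y + z) > 2, and k = l = 1 would give x + w = 0. -/
theorem Admissible.pair {k l : ℕ} (h : Admissible [k, l]) (hk : 1 ≤ k) (hl : 1 ≤ l) :
    (k = 1 ∧ 2 ≤ l) ∨ (l = 1 ∧ 2 ≤ k) ∨ (k = 2 ∧ 2 ≤ l ∧ l ≤ 4) ∨ (l = 2 ∧ 2 ≤ k ∧ k ≤ 4) := by
  obtain ⟨x, y, h⟩ := h
  simp only [orbit_cons_iff, orbit_nil_iff] at h
  obtain ⟨⟨_, _, hy, _, _⟩, z, ek, ⟨_, _, hz, _, _⟩, w, el, _, _, _, _, _⟩ := h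
  have h33 : ¬ (3 ≤ k ∧ 3 ≤ l) := fun ⟨h1, h2⟩ => by
    have := index_mul_le ek hy h1
    have := index_mul_le el hz h2
    push_cast at *
    linarith
  have h11 : ¬ (k ≤ 1 ∧ l ≤ 1) := fun ⟨h1, h2⟩ => by
    have := le_index_mul ek hy h1
    have := le_index_mul el hz h2
    push_cast at *
    linarith
  have h25 : ¬ (2 ≤ k ∧ 5 ≤ l) := fun ⟨h1, h2⟩ => by
    have := index_mul_le ek hy h1
    have := index_mul_le el hz h2
    push_cast at *
    linarith
  have h52 : ¬ (5 ≤ k ∧ 2 ≤ l) := fun ⟨h1, h2⟩ => by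
    have := index_mul_le ek hy h1
    have := index_mul_le el hz h2
    push_cast at *
    linarith
  omega

theorem Admissible.triple_one {k l : ℕ} (h : Admissible [k, 1, l]) :
    ¬ (k ≤ 2 ∧ l ≤ 5) ∧ ¬ (k ≤ 5 ∧ l ≤ 2) ∧ ¬ (k ≤ 3 ∧ l ≤ 3) ∧ ¬ (3 ≤ k ∧ 9 ≤ l) ∧
      ¬ (9 ≤ k ∧ 3 ≤ l) ∧ ¬ (4 ≤ k ∧ 6 ≤ l) ∧ ¬ (6 ≤ k ∧ 4 ≤ l) ∧ ¬ (5 ≤ k ∧ 5 ≤ l) := by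
  obtain ⟨x, y, h⟩ := h
  simp only [orbit_cons_iff, orbit_nil_iff, Nat.cast_one, one_mul] at h
  obtain ⟨⟨_, _, hy, _, _⟩, z, ek, ⟨_, _, hz, _, _⟩, w, e1, ⟨_, _, hw, _, _⟩, u, el,
    _, _, _, _, _⟩ := h
  refine ⟨?_, ?_, ?_, ?_, ?_, ?_, ?_, ?_⟩ <;> rintro ⟨h1, h2⟩
  iterate 3
    · have := le_index_mul ek hy h1
      have := le_index_mul el hw h2
      push_cast at *
      linarith
  all_goals
    have := index_mul_le ek hy h1
    have := index_mul_le el hw h2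
    push_cast at *
    linarith

theorem Admissible.triple_two {k l : ℕ} (h : Admissible [k, 2, l]) :
    ¬ (k ≤ 1 ∧ l ≤ 1) ∧ ¬ (4 ≤ k ∧ 2 ≤ l) ∧ ¬ (2 ≤ k ∧ 4 ≤ l) := by
  obtain ⟨x, y, h⟩ := h
  simp only [orbit_cons_iff, orbit_nil_iff] at h
  obtain ⟨⟨_, _, hy, _, _⟩, z, ek, ⟨_, _, hz, _, _⟩, w, e1, ⟨_, _, hw, _, _⟩, u, el,
    _, _, _, _, _⟩ := h
  refine ⟨?_, ?_, ?_⟩ <;> rintro ⟨h1, h2⟩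
  · have := le_index_mul ek hy h1
    have := le_index_mul el hw h2
    push_cast at *
    linarith
  all_goals
    have := index_mul_le ek hy h1
    have := index_mul_le el hw h2
    push_cast at *
    linarith

theorem not_admissible_two_four_two : ¬ Admissible [2, 4, 2] := by
  rintro ⟨x, y, h⟩
  simp only [orbit_cons_iff, orbit_nil_iff] at h
  obtain ⟨⟨_, _, _, _, _⟩, z, _, ⟨_, _, _, _, _⟩, w, _, ⟨_, _, _, _, _⟩, u, _,
    _, _, _, _, _⟩ := h
  push_cast at *
  linarith

theorem not_admissible_five_one_four_two : ¬ Admissible [5, 1, 4, 2] := by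
  rintro ⟨x, y, h⟩
  simp only [orbit_cons_iff, orbit_nil_iff] at h
  obtain ⟨⟨_, _, _, _, _⟩, z, _, ⟨_, _, _, _, _⟩, w, _, ⟨_, _, _, _, _⟩, u, _,
    ⟨_, _, _, _, _⟩, v, _, _, _, _, _, _⟩ := h
  push_cast at *
  linarith

theorem not_admissible_two_four_one_five : ¬ Admissible [2, 4, 1, 5] := by
  rintro ⟨x, y, h⟩
  simp only [orbit_cons_iff, orbit_nil_iff] at h
  obtain ⟨⟨_, _, _, _, _⟩, z, _, ⟨_, _, _, _, _⟩, w, _, ⟨_, _, _, _, _⟩, u, _,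
    ⟨_, _, _, _, _⟩, v, _, _, _, _, _, _⟩ := h
  push_cast at *
  linarith

theorem Admissible.one_two_three {k : ℕ} (h : Admissible [k, 1, 2, 3]) : 7 ≤ k ∧ k ≤ 12 := by
  obtain ⟨x, y, h⟩ := h
  simp only [orbit_cons_iff, orbit_nil_iff] at h
  obtain ⟨⟨_, _, hy, _, _⟩, z, ek, ⟨_, _, _, _, _⟩, w, _, ⟨_, _, _, _, _⟩, u, _,
    ⟨_, _, _, _, _⟩, v, _, _, _, _, _, _⟩ := h
  constructor <;> by_contra hk
  · have := le_index_mul (c := 6) ek hy (by omega)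
    push_cast at *
    linarith
  · have := index_mul_le (c := 13) ek hy (by omega)
    push_cast at *
    linarith

theorem Admissible.one_two_four {k : ℕ} (h : Admissible [k, 1, 2, 4]) : 6 ≤ k ∧ k ≤ 8 := by
  obtain ⟨x, y, h⟩ := h
  simp only [orbit_cons_iff, orbit_nil_iff] at h
  obtain ⟨⟨_, _, hy, _, _⟩, z, ek, ⟨_, _, _, _, _⟩, w, _, ⟨_, _, _, _, _⟩, u, _,
    ⟨_, _, _, _, _⟩, v, _, _, _, _, _, _⟩ := h
  constructor <;> by_contra hk
  · have := le_index_mul (c := 5) ek hy (by omega)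
    push_cast at *
    linarith
  · have := index_mul_le (c := 9) ek hy (by omega)
    push_cast at *
    linarith

theorem Admissible.four_two_one {k : ℕ} (h : Admissible [4, 2, 1, k]) : 6 ≤ k ∧ k ≤ 8 := by
  obtain ⟨x, y, h⟩ := h
  simp only [orbit_cons_iff, orbit_nil_iff] at h
  obtain ⟨⟨_, _, _, _, _⟩, z, _, ⟨_, _, _, _, _⟩, w, _, ⟨_, _, _, _, _⟩, u, _,
    ⟨_, _, hy, _, _⟩, v, ek, _, _, _, _, _⟩ := h
  constructor <;> by_contra hk
  · have := le_index_mul (c := 5) ek hy (by omega)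
    push_cast at *
    linarith
  · have := index_mul_le (c := 9) ek hy (by omega)
    push_cast at *
    linarith

theorem Admissible.one_five_one {k l : ℕ} (h : Admissible [k, 1, 5, 1, l]) :
    ¬ (4 ≤ k ∧ 4 ≤ l) ∧ ¬ (k ≤ 2 ∨ 5 ≤ k) ∧ ¬ (l ≤ 2 ∨ 5 ≤ l) := by
  have hl : Admissible [k, 1, 5] := h.of_append_left (l := [k, 1, 5])
  have hl := hl.triple_one
  have hr := h.tail.tail.triple_one
  refine ⟨?_, by omega, by omega⟩
  rintro ⟨h1, h2⟩
  obtain ⟨x, y, h⟩ := h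
  simp only [orbit_cons_iff, orbit_nil_iff] at h
  obtain ⟨⟨_, _, hy, _, _⟩, z, ek, ⟨_, _, _, _, _⟩, w, _, ⟨_, _, _, _, _⟩, u, _,
    ⟨_, _, _, _, _⟩, v, _, ⟨_, _, hv, _, _⟩, t, el, _, _, _, _, _⟩ := h
  have := index_mul_le ek hy h1
  have := index_mul_le el hv h2
  push_cast at *
  linarith

theorem Admissible.one_eight_one {k l : ℕ} (h : Admissible [k, 1, 8, 1, l]) :
    ¬ (3 ≤ k ∧ 3 ≤ l) ∧ ¬ 4 ≤ k ∧ ¬ 4 ≤ l := by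
  have hl : Admissible [k, 1, 8] := h.of_append_left (l := [k, 1, 8])
  have hl := hl.triple_one
  have hr := h.tail.tail.triple_one
  refine ⟨?_, by omega, by omega⟩
  rintro ⟨h1, h2⟩
  obtain ⟨x, y, h⟩ := h
  simp only [orbit_cons_iff, orbit_nil_iff] at h
  obtain ⟨⟨_, _, hy, _, _⟩, z, ek, ⟨_, _, _, _, _⟩, w, _, ⟨_, _, _, _, _⟩, u, _,
    ⟨_, _, _, _, _⟩, v, _, ⟨_, _, hv, _, _⟩, t, el, _, _, _, _, _⟩ := h
  have := index_mul_le ek hy h1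
  have := index_mul_le el hv h2
  push_cast at *
  linarith

/-- After the first 1 the progression descends by x, so the closing 1 would produce the value -x. -/
theorem not_admissible_one_replicate_two_one (n : ℕ) :
    ¬ Admissible (1 :: (List.replicate n 2 ++ [1])) := by
  rintro ⟨x, y, h⟩
  obtain ⟨h, z, e, h'⟩ := orbit_cons_iff.1 h
  have h' := h'.replicate_two
  simp only [orbit_cons_iff, orbit_nil_iff] at h'
  obtain ⟨-, w, e', -, -, hw, -⟩ := h'
  push_cast at e e'
  linarith [h.1]

/-- The range of the first index in a pattern `(k, 1, 2, …, 2, 3)`. -/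
theorem Admissible.one_replicate_two_three {k n : ℕ}
    (h : Admissible (k :: 1 :: (List.replicate n 2 ++ [3]))) : 4 * n + 2 ≤ k ∧ k ≤ 4 * n + 8 := by
  obtain ⟨x, y, h⟩ := h
  obtain ⟨⟨_, _, hy, _, _⟩, z, ek, h⟩ := orbit_cons_iff.1 h
  obtain ⟨⟨_, _, hz, _, _⟩, w, e, h⟩ := orbit_cons_iff.1 h
  have h := h.replicate_two
  simp only [orbit_cons_iff, orbit_nil_iff] at h
  obtain ⟨⟨_, _, _, _, _⟩, u, eu, _, _, _, _, _⟩ := h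
  obtain rfl : w = z - y := by push_cast at e; linarith
  push_cast at eu
  -- Lower bound: z ≤ 1, x + y > 1, and the pair before index 3 has sum 2z - (2n+1)y > 1. Upper
  -- bound: x ≤ 1, y + z > 1, and the final value 2z - (2n+3)y is at most 1.
  constructor <;> by_contra hk
  · have := le_index_mul (c := 4 * n + 1) ek hy (by omega)
    push_cast at this
    nlinarith
  · have := index_mul_le (c := 4 * n + 9) ek hy (by omega)
    push_cast at this
    nlinarith

theorem Admissible.eq_two_of_mod_three {m : ℕ} : ∀ {k : ℕ} {l : List ℕ},
    Admissible (k :: l) → k % 3 = 2 → (∀ a ∈ l, a % 3 = 2) → m ∈ l → k = 2 ∧ m = 2 := by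
  intro k l
  induction l generalizing k with
  | nil => simp
  | cons a l ih =>
    intro h hk hl hm
    have ha := hl a (by simp)
    have h2 : Admissible [k, a] := h.of_append_left (l := [k, a])
    have := h2.pair (by omega) (by omega)
    rcases List.mem_cons.1 hm with rfl | hm
    · omega
    · have := ih h.tail ha (fun b hb => hl b (by simp [hb])) hm
      omega

/-! ### The first hit of the residue `2` modulo `3` -/

/-- The continuant read from the left, started from the pair `(c, p)` of consecutive values,
reaches the residue `2` modulo `3` exactly at the end of the list. -/
def FirstHit : ℤ → ℤ → List ℕ → Prop
  | c, _, [] => c % 3 = 2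
  | c, p, k :: l => c % 3 ≠ 2 ∧ FirstHit (c * k - p) c l

/-- The continuant recursion read from the left, started from the pair `(c, p)`. -/
def continuantFrom : ℤ → ℤ → List ℕ → ℤ
  | c, _, [] => c
  | c, p, k :: l => continuantFrom (c * k - p) c l

/-- The left-to-right recursion is linear in its starting pair; this links it to `continuant`, which
peels off the front. -/
theorem continuantFrom_cons_eq (k : ℕ) : ∀ (l : List ℕ) (c p : ℤ),
    continuantFrom c p (k :: l) = c * continuant (k :: l) - p * continuant l
  | [], c, p => by simp [continuantFrom, continuant]
  | m :: l, c, p => by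
    have := continuantFrom_cons_eq m l (c * k - p) c
    rw [continuantFrom, this]
    simp only [continuant]
    ring

theorem continuantFrom_one_zero (l : List ℕ) : continuantFrom 1 0 l = continuant l := by
  cases l with
  | nil => rfl
  | cons k l => rw [continuantFrom_cons_eq]; ring

theorem firstHit_iff {l : List ℕ} : ∀ {c p : ℤ}, FirstHit c p l ↔
    (∀ i < l.length, continuantFrom c p (l.take i) % 3 ≠ 2) ∧ continuantFrom c p l % 3 = 2 := by
  induction l with
  | nil => intro c p; simp [FirstHit, continuantFrom]
  | cons k l ih =>
    intro c p
    rw [FirstHit, ih, ← and_assoc]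
    refine and_congr_left fun _ => ?_
    constructor
    · rintro ⟨h, h'⟩ i hi
      cases i with
      | zero => exact h
      | succ i => exact h' i (by simpa using hi)
    · intro h
      exact ⟨h 0 (by simp), fun i hi => h (i + 1) (by simpa using hi)⟩

/-- Makes the state (c, p) an element of a finite set, so that letters act through their residues.
-/
theorem FirstHit.congr {l : List ℕ} : ∀ {c p c' p' : ℤ}, FirstHit c p l →
    c % 3 = c' % 3 → p % 3 = p' % 3 → FirstHit c' p' l := by
  induction l with
  | nil => intro c p c' p' h hc _; exact hc.symm.trans h
  | cons k l ih =>
    intro c p c' p' h hc hp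
    exact ⟨hc ▸ h.1, ih h.2 (Int.ModEq.sub (Int.ModEq.mul_right (k : ℤ) hc) hp) hc⟩

theorem mem_tupleSet_iff {r : ℕ} {c₀ : ℤ} (hc : c₀ % 3 ≠ 0) {k : List ℕ} :
    k ∈ tupleSet r 3 c₀ 0 ↔
      k.length = r ∧ (∀ a ∈ k, 1 ≤ a) ∧
        ((∀ i, 1 ≤ i → i < r → continuant (k.take i).tail % 3 ≠ 2) ∧
          continuant k.tail % 3 = 2) ∧ Admissible k := by
  have key : ∀ a b : ℤ, 0 * a - c₀ * b ≡ c₀ [ZMOD 3] ↔ b % 3 = 2 := by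
    intro a b
    have h1 : c₀ % 3 = 1 ∨ c₀ % 3 = 2 := by omega
    have h2 : b % 3 = 0 ∨ b % 3 = 1 ∨ b % 3 = 2 := by omega
    rw [Int.ModEq, zero_mul, Int.sub_emod, Int.mul_emod]
    rcases h1 with h1 | h1 <;> rcases h2 with h2 | h2 | h2 <;> simp [h1, h2]
  simp only [tupleSet, Set.mem_ofPred_eq, key, bczRegion_nonempty_iff, ne_eq, and_assoc]

theorem cons_mem_tupleSet_iff {r : ℕ} {k : ℕ} {l : List ℕ} :
    k :: l ∈ tupleSet r 3 1 0 ↔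
      l.length + 1 = r ∧ (∀ a ∈ k :: l, 1 ≤ a) ∧ FirstHit 1 0 l ∧ Admissible (k :: l) := by
  rw [mem_tupleSet_iff (by norm_num), List.length_cons]
  refine and_congr_right fun hr => and_congr_right fun _ => and_congr_left fun _ => ?_
  subst hr
  rw [firstHit_iff]
  simp only [continuantFrom_one_zero, List.tail_cons]
  refine and_congr_left fun _ => ⟨fun h i hi => ?_, fun h i hi hi' => ?_⟩
  · exact h (i + 1) (by omega) (by omega)
  · obtain ⟨i, rfl⟩ := Nat.exists_eq_add_of_le' hi
    exact h i (by omega)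

theorem FirstHit.of_one_one {l : List ℕ} (h : FirstHit 1 1 l) :
    ∃ ms : List ℕ, (∀ m ∈ ms, m % 3 = 2) ∧
      ((∃ b, b % 3 = 0 ∧ l = ms ++ [b]) ∨ ∃ b x, b % 3 = 1 ∧ l = ms ++ [b, x]) := by
  induction l with
  | nil => simp [FirstHit] at h
  | cons k l ih =>
    have h := h.2
    have hk : k % 3 = 0 ∨ k % 3 = 1 ∨ k % 3 = 2 := by omega
    rcases hk with hk | hk | hk
    · refine ⟨[], by simp, Or.inl ⟨k, hk, ?_⟩⟩
      cases l with
      | nil => rfl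
      | cons m l => exact absurd (by omega) h.1
    · refine ⟨[], by simp, Or.inr ?_⟩
      have h := h.congr (c' := 0) (p' := 1) (by omega) rfl
      rcases l with _ | ⟨m, _ | ⟨q, l⟩⟩
      · simp [FirstHit] at h
      · exact ⟨k, m, hk, rfl⟩
      · simp [FirstHit] at h
    · obtain ⟨ms, hms, h⟩ := ih (h.congr (by omega) rfl)
      refine ⟨k :: ms, by simpa [hk] using hms, ?_⟩
      rcases h with ⟨b, hb, rfl⟩ | ⟨b, x, hb, rfl⟩
      · exact Or.inl ⟨b, hb, rfl⟩
      · exact Or.inr ⟨b, x, hb, rfl⟩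

theorem FirstHit.of_one_zero {l : List ℕ} (h : FirstHit 1 0 l) :
    (∃ a, a % 3 = 2 ∧ l = [a]) ∨ (∃ a b, a % 3 = 0 ∧ l = [a, b]) ∨
      ∃ (a : ℕ) (ms : List ℕ), a % 3 = 1 ∧ (∀ m ∈ ms, m % 3 = 2) ∧
        ((∃ b, b % 3 = 0 ∧ l = a :: (ms ++ [b])) ∨
          ∃ b x, b % 3 = 1 ∧ l = a :: (ms ++ [b, x])) := by
  rcases l with _ | ⟨k, l⟩
  · simp [FirstHit] at h
  have h := h.2
  have hk : k % 3 = 0 ∨ k % 3 = 1 ∨ k % 3 = 2 := by omega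
  rcases hk with hk | hk | hk
  · have h := h.congr (c' := 0) (p' := 1) (by omega) rfl
    rcases l with _ | ⟨m, _ | ⟨q, l⟩⟩
    · simp [FirstHit] at h
    · exact Or.inr (Or.inl ⟨k, m, hk, rfl⟩)
    · simp [FirstHit] at h
  · obtain ⟨ms, hms, h⟩ := (h.congr (c' := 1) (p' := 1) (by omega) rfl).of_one_one
    refine Or.inr (Or.inr ⟨k, ms, hk, hms, ?_⟩)
    simpa using h
  · refine Or.inl ⟨k, hk, ?_⟩
    cases l with
    | nil => rfl
    | cons m l => exact absurd (by omega) h.1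

theorem firstHit_replicate_two_three (n : ℕ) : FirstHit 1 1 (List.replicate n 2 ++ [3]) := by
  induction n with
  | zero => simp [FirstHit]
  | succ n ih => exact ⟨by norm_num, ih⟩

/-! ### The table is complete -/

theorem Admissible.of_append_right {l' : List ℕ} : ∀ {l : List ℕ},
    Admissible (l ++ l') → Admissible l'
  | [], h => h
  | _ :: _, h => Admissible.of_append_right h.tail

theorem exists_tupleTable_two {k a : ℕ} (h : Admissible [k, a]) (hk : 1 ≤ k) (ha : a % 3 = 2) :
    ∃ v, TupleTable 2 [k, a] v := by
  rcases h.pair hk (by omega) with ⟨rfl, h2⟩ | h2 | ⟨rfl, h2⟩ | ⟨rfl, h2, h3⟩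
  · exact ⟨_, .row2_1 a ha h2⟩
  · omega
  · obtain rfl : a = 2 := by omega
    exact ⟨_, .row2_2⟩
  · interval_cases k
    exacts [⟨_, .row2_2⟩, ⟨_, .row2_3⟩, ⟨_, .row2_4⟩]

theorem exists_tupleTable_three {k a b : ℕ} (h : Admissible [k, a, b]) (hk : 1 ≤ k)
    (ha : 1 ≤ a) (hb : 1 ≤ b) (hab : a % 3 = 0 ∨ a % 3 = 1 ∧ b % 3 = 0) :
    ∃ v, TupleTable 3 [k, a, b] v := by
  have h1 := (h.of_append_left (l := [k, a])).pair hk ha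
  have h2 := h.tail.pair ha hb
  rcases hab with ha' | ⟨ha', hb'⟩
  · rcases eq_or_ne k 1 with rfl | hk1 <;> rcases eq_or_ne b 1 with rfl | hb1
    · exact ⟨_, .row3_1 a ha' (by omega)⟩
    · obtain ⟨rfl, rfl⟩ : a = 3 ∧ b = 2 := by omega
      exact ⟨_, .row3_3a⟩
    · obtain ⟨rfl, rfl⟩ : a = 3 ∧ k = 2 := by omega
      exact ⟨_, .row3_3b⟩
    · obtain ⟨rfl, rfl, rfl⟩ : a = 3 ∧ k = 2 ∧ b = 2 := by omega
      exact ⟨_, .row3_4⟩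
  · obtain rfl : a = 1 := by omega
    have h3 := h.triple_one
    have h4 : (k = 2 ∧ 6 ≤ b) ∨ (k = 3 ∧ b = 6) ∨ (b = 3 ∧ 4 ≤ k ∧ k ≤ 8) := by omega
    rcases h4 with ⟨rfl, h4⟩ | ⟨rfl, rfl⟩ | ⟨rfl, h4, h5⟩
    exacts [⟨_, .row3_2 b hb' h4⟩, ⟨_, .row3_5⟩, ⟨_, .row3_6 k h4 h5⟩]

theorem exists_tupleTable_four_of_two {k a m b : ℕ} (h : Admissible [k, a, m, b])
    (ha : a % 3 = 1) (hm : m % 3 = 2) (hb : 1 ≤ b) (hb' : b % 3 = 0) :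
    ∃ v, TupleTable 4 [k, a, m, b] v := by
  have h1 := h.tail.tail.pair (by omega) hb
  obtain ⟨rfl, rfl⟩ : m = 2 ∧ b = 3 := by omega
  have h2 := h.tail.triple_two
  obtain rfl : a = 1 := by omega
  obtain ⟨h3, h4⟩ := h.one_two_three
  exact ⟨_, .row4_9 k h3 h4⟩

theorem exists_tupleTable_four_of_one {k a b x : ℕ} (h : Admissible [k, a, b, x]) (hk : 1 ≤ k)
    (ha : a % 3 = 1) (hb : b % 3 = 1) (hx : 1 ≤ x) :
    ∃ v, TupleTable 4 [k, a, b, x] v := by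
  have h1 := (h.of_append_left (l := [k, a])).pair hk (by omega)
  have h2 := (h.tail.of_append_left (l := [a, b])).pair (by omega) (by omega)
  have h3 := h.tail.tail.pair (by omega) hx
  rcases eq_or_ne a 1 with rfl | ha1
  · have h4 := (h.of_append_left (l := [k, 1, b])).triple_one
    have h5 : (k = 2 ∧ 7 ≤ b ∧ x = 1) ∨ (k = 3 ∧ b = 7 ∧ x = 1) ∨
        (b = 4 ∧ 3 ≤ k ∧ k ≤ 5 ∧ 1 ≤ x ∧ x ≤ 2) := by omega
    rcases h5 with ⟨rfl, h5, rfl⟩ | ⟨rfl, rfl, rfl⟩ | ⟨rfl, h5, h6, h7, h8⟩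
    · exact ⟨_, .row4_2 b hb h5⟩
    · exact ⟨_, .row4_7b⟩
    · interval_cases x <;> interval_cases k
      exacts [⟨_, .row4_3b⟩, ⟨_, .row4_4b⟩, ⟨_, .row4_5b⟩, ⟨_, .row4_6b⟩, ⟨_, .row4_8b⟩,
        absurd h not_admissible_five_one_four_two]
  · obtain rfl : b = 1 := by omega
    have h4 := h.tail.triple_one
    have h5 : (x = 2 ∧ 7 ≤ a ∧ k = 1) ∨ (x = 3 ∧ a = 7 ∧ k = 1) ∨
        (a = 4 ∧ 3 ≤ x ∧ x ≤ 5 ∧ 1 ≤ k ∧ k ≤ 2) := by omega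
    rcases h5 with ⟨rfl, h5, rfl⟩ | ⟨rfl, rfl, rfl⟩ | ⟨rfl, h5, h6, h7, h8⟩
    · exact ⟨_, .row4_1 a ha h5⟩
    · exact ⟨_, .row4_7a⟩
    · interval_cases k <;> interval_cases x
      exacts [⟨_, .row4_3a⟩, ⟨_, .row4_4a⟩, ⟨_, .row4_5a⟩, ⟨_, .row4_6a⟩, ⟨_, .row4_8a⟩,
        absurd h not_admissible_two_four_one_five]

theorem exists_tupleTable_five {k a m b x : ℕ} (h : Admissible [k, a, m, b, x]) (hk : 1 ≤ k)
    (ha : a % 3 = 1) (hm : m % 3 = 2) (hb : b % 3 = 1) (hx : 1 ≤ x) :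
    ∃ v, TupleTable 5 [k, a, m, b, x] v := by
  have h1 := (h.of_append_left (l := [k, a])).pair hk (by omega)
  have h2 := (h.tail.of_append_left (l := [a, m])).pair (by omega) (by omega)
  have h3 := (h.tail.tail.of_append_left (l := [m, b])).pair (by omega) (by omega)
  have h4 := h.tail.tail.tail.pair (by omega) hx
  rcases eq_or_ne m 2 with rfl | hm2
  · have h5 := (h.tail.of_append_left (l := [a, 2, b])).triple_two
    have h6 : (a = 1 ∧ b = 4) ∨ (a = 4 ∧ b = 1) := by omega
    rcases h6 with ⟨rfl, rfl⟩ | ⟨rfl, rfl⟩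
    · obtain ⟨h7, h8⟩ := (h.of_append_left (l := [k, 1, 2, 4])).one_two_four
      have hx2 : x ≠ 2 := by
        rintro rfl
        exact not_admissible_two_four_two h.tail.tail
      obtain rfl : x = 1 := by omega
      exact ⟨_, .row5_3 k h7 h8⟩
    · obtain ⟨h7, h8⟩ := h.tail.four_two_one
      have hk2 : k ≠ 2 := by
        rintro rfl
        exact not_admissible_two_four_two (h.of_append_left (l := [2, 4, 2]))
      obtain rfl : k = 1 := by omega
      exact ⟨_, .row5_4 x h7 h8⟩
  · obtain ⟨rfl, rfl⟩ : a = 1 ∧ b = 1 := by omega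
    have h5 := (h.of_append_left (l := [k, 1, m])).triple_one
    have h6 := h.tail.tail.triple_one
    -- From 9 on, a middle index forces both outer indices to be 2; only 5 and 8 leave other
    -- choices.
    have h7 : m = 5 ∨ m = 8 ∨ 11 ≤ m := by omega
    rcases h7 with rfl | rfl | h7
    · have h8 := h.one_five_one
      have h9 : (k = 3 ∧ x = 3) ∨ (k = 3 ∧ x = 4) ∨ (k = 4 ∧ x = 3) := by omega
      rcases h9 with ⟨rfl, rfl⟩ | ⟨rfl, rfl⟩ | ⟨rfl, rfl⟩
      exacts [⟨_, .row5_5⟩, ⟨_, .row5_7a⟩, ⟨_, .row5_7b⟩]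
    · have h8 := h.one_eight_one
      have h9 : (k = 2 ∧ x = 2) ∨ (k = 2 ∧ x = 3) ∨ (k = 3 ∧ x = 2) := by omega
      rcases h9 with ⟨rfl, rfl⟩ | ⟨rfl, rfl⟩ | ⟨rfl, rfl⟩
      exacts [⟨_, .row5_1 8 rfl le_rfl⟩, ⟨_, .row5_6a⟩, ⟨_, .row5_6b⟩]
    · obtain ⟨rfl, rfl⟩ : k = 2 ∧ x = 2 := by omega
      exact ⟨_, .row5_1 m hm (by omega)⟩

/-- A run of at least two indices congruent to `2` modulo `3` consists of twos, an index
congruent to `1` before it is `1`, and an index after it is at most `3`. -/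
theorem Admissible.run_eq_replicate {a b : ℕ} {ms : List ℕ} (h : Admissible (a :: (ms ++ [b])))
    (ha : a % 3 = 1) (hms : ∀ m ∈ ms, m % 3 = 2) (hlen : 2 ≤ ms.length) :
    a = 1 ∧ b ≤ 3 ∧ ∃ n, ms = List.replicate (n + 2) 2 := by
  obtain ⟨m₁, m₂, ms, rfl⟩ : ∃ m₁ m₂ l, ms = m₁ :: m₂ :: l := by
    rcases ms with _ | ⟨m₁, _ | ⟨m₂, l⟩⟩
    · simp at hlen
    · simp at hlen
    · exact ⟨_, _, _, rfl⟩
  have hr : m₁ :: m₂ :: ms = List.replicate (ms.length + 2) 2 := by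
    have h' := h.tail.of_append_left (l := m₁ :: m₂ :: ms)
    have h0 := h'.eq_two_of_mod_three (m := m₂) (hms _ (by simp))
      (fun a ha => hms a (by simp_all)) (by simp)
    refine List.eq_replicate_iff.2 ⟨by simp, fun m hm => ?_⟩
    rcases List.mem_cons.1 hm with rfl | hm
    · exact h0.1
    · exact (h'.eq_two_of_mod_three (hms _ (by simp)) (fun a ha => hms a (by simp_all)) hm).2
  rw [hr] at h
  have h2 : Admissible [a, 2, 2] := h.of_append_left (l := [a, 2, 2])
    (l' := List.replicate ms.length 2 ++ [b])
  have h3 : Admissible [2, 2, b] := by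
    refine Admissible.of_append_right (l := a :: List.replicate ms.length 2) ?_
    rw [← List.replicate_append_replicate] at h
    simpa using h
  have h2 := h2.triple_two
  have h3 := h3.triple_two
  exact ⟨by omega, by omega, _, hr⟩

theorem exists_tupleTable {k : ℕ} {l : List ℕ} (h : Admissible (k :: l))
    (hpos : ∀ a ∈ k :: l, 1 ≤ a) (hl : FirstHit 1 0 l) :
    ∃ v, TupleTable (l.length + 1) (k :: l) v := by
  have hk := hpos k (by simp)
  rcases hl.of_one_zero with ⟨a, ha, rfl⟩ | ⟨a, b, ha, rfl⟩ | ⟨a, ms, ha, hms, hl'⟩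
  · exact exists_tupleTable_two h hk ha
  · exact exists_tupleTable_three h hk (hpos a (by simp)) (hpos b (by simp)) (Or.inl ha)
  rcases Nat.lt_or_ge ms.length 2 with hlen | hlen
  · rcases ms with _ | ⟨m, _ | ⟨m', ms⟩⟩
    · rcases hl' with ⟨b, hb, rfl⟩ | ⟨b, x, hb, rfl⟩
      · exact exists_tupleTable_three h hk (hpos a (by simp)) (hpos b (by simp)) (Or.inr ⟨ha, hb⟩)
      · exact exists_tupleTable_four_of_one h hk ha hb (hpos x (by simp))
    · have hm := hms m (by simp)
      rcases hl' with ⟨b, hb, rfl⟩ | ⟨b, x, hb, rfl⟩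
      · exact exists_tupleTable_four_of_two h ha hm (hpos b (by simp)) hb
      · exact exists_tupleTable_five h hk ha hm hb (hpos x (by simp))
    · simp at hlen
  · rcases hl' with ⟨b, hb, rfl⟩ | ⟨b, x, hb, rfl⟩
    · obtain ⟨rfl, hb3, n, rfl⟩ := h.tail.run_eq_replicate ha hms hlen
      have := hpos b (by simp)
      obtain rfl : b = 3 := by omega
      obtain ⟨h1, h2⟩ := h.one_replicate_two_three
      rcases Nat.eq_zero_or_pos n with rfl | hn
      · exact ⟨_, .row5_2 k (by omega) (by omega)⟩
      · have := TupleTable.row6 (n + 5) k (by omega) (by omega) (by omega)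
        exact ⟨_, by simpa using this⟩
    · have h' : Admissible (a :: (ms ++ [b])) :=
        Admissible.of_append_left (l' := [x]) (by simpa using h.tail)
      obtain ⟨rfl, hb3, n, rfl⟩ := h'.run_eq_replicate ha hms hlen
      obtain rfl : b = 1 := by omega
      exact absurd h' (not_admissible_one_replicate_two_one _)

/-! ### The rows of the table are admissible -/

theorem orbit_cons_eq {x y : ℝ} {k : ℕ} {l : List ℕ} :
    Orbit x y (k :: l) ↔ (0 < x ∧ x ≤ 1 ∧ 0 < y ∧ y ≤ 1 ∧ 1 < x + y) ∧ Orbit y (k * y - x) l :=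
  Iff.rfl

theorem orbit_one_replicate_two_three {k n : ℕ} {e y : ℝ} (he : 0 < e) (hy : y ≤ 1)
    (hey : 1 < y + e) (hk : k * e - y ≤ 1) (hk' : 1 < (k + 1) * e - y)
    (h₁ : 2 * y - (2 * n + 3) * e ≤ 1) (h₂ : 1 < 3 * y - (3 * n + 4) * e)
    (h₃ : 1 < 2 * y - (2 * n + 1) * e) :
    Orbit (k * e - y) e (k :: 1 :: (List.replicate n 2 ++ [3])) := by
  have h0 : 0 ≤ (n : ℝ) * e := by positivity
  rw [orbit_cons_eq, orbit_cons_eq]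
  refine ⟨⟨by linarith, hk, he, by linarith, by linarith⟩,
    ⟨he, by linarith, by linarith, by linarith, by linarith⟩,
    orbit_replicate_two (by linarith) (by push_cast; linarith) ?_⟩
  simp only [orbit_cons_eq, orbit_nil_iff]
  push_cast
  refine ⟨⟨?_, ?_, ?_, ?_, ?_⟩, ?_, ?_, ?_, ?_, ?_⟩ <;> linarith

theorem admissible_one_replicate_two_three {k n : ℕ} (hn : 2 ≤ n) (h : 4 * n + 2 ≤ k)
    (h' : k ≤ 4 * n + 8) : Admissible (k :: 1 :: (List.replicate n 2 ++ [3])) := by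
  have hn₀ : (2 : ℝ) ≤ n := by exact_mod_cast hn
  have h₀ : (4 : ℝ) * n + 2 ≤ k := by exact_mod_cast h
  have h₀' : (k : ℝ) ≤ 4 * n + 8 := by exact_mod_cast h'
  -- Two witnesses are needed: the second satisfies `h₃` only for k ≥ 4n + 5, while the first
  -- satisfies `h₁` only for k ≤ 4n + 5. The first also needs n ≥ 2 for `h₂` at k = 4n + 2.
  rcases Nat.lt_or_ge k (4 * n + 5) with hk | hk
  · have hk₀ : (k : ℝ) + 1 ≤ 4 * n + 5 := by exact_mod_cast hk
    have hd : (0 : ℝ) < 2 * k + 1 := by positivity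
    have he : (0 : ℝ) < 4 / (2 * k + 1) := by positivity
    -- With y = 1 the index k requires 2/(k+1) < e ≤ 2/k; the mediant is taken.
    refine ⟨_, _, orbit_one_replicate_two_three (e := 4 / (2 * k + 1)) (y := 1) he le_rfl
      (by linarith) ?_ ?_ ?_ ?_ ?_⟩ <;> field_simp <;> linarith
  · have hk₀ : (4 : ℝ) * n + 5 ≤ k := by exact_mod_cast hk
    have hd : (0 : ℝ) < 3 * k + 2 := by positivity
    have he : (0 : ℝ) < 6 / (3 * k + 2) := by positivity
    -- Here the orbit starts at x = ke - y = 1, and `h₁` becomes exactly k ≤ 4n + 8.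
    refine ⟨_, _, orbit_one_replicate_two_three (e := 6 / (3 * k + 2)) (y := 1 - 4 / (3 * k + 2))
      he ?_ ?_ ?_ ?_ ?_ ?_ ?_⟩ <;> field_simp <;> linarith

/-- In the families with unbounded a and bounded length, the orbit passes through 1 and then s,
where index a requires 2/(a+1) < s ≤ 2/a. The choices are s = 2/a, which makes both neighbours of s
equal to 1, or s = 4/(2a+1). -/
theorem TupleTable.admissible {r : ℕ} {k : List ℕ} {v : ℤ} (h : TupleTable r k v) :
    Admissible k := by
  cases h with
  | row2_1 a h h' =>
    have ha : (2 : ℝ) ≤ a := by exact_mod_cast h'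
    refine ⟨1 - 4 / (2 * a + 1), 1, ?_⟩
    simp only [orbit_cons_eq, orbit_nil_iff]
    push_cast
    refine ⟨⟨?_, ?_, ?_, ?_, ?_⟩, ⟨?_, ?_, ?_, ?_, ?_⟩, ?_, ?_, ?_, ?_, ?_⟩ <;>
      field_simp <;> linarith
  | row3_1 a h h' =>
    have ha : (3 : ℝ) ≤ a := by exact_mod_cast h'
    refine ⟨1 - 2 / a, 1, ?_⟩
    simp only [orbit_cons_eq, orbit_nil_iff]
    push_cast
    refine ⟨⟨?_, ?_, ?_, ?_, ?_⟩, ⟨?_, ?_, ?_, ?_, ?_⟩, ⟨?_, ?_, ?_, ?_, ?_⟩,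
      ?_, ?_, ?_, ?_, ?_⟩ <;> field_simp <;> linarith
  | row3_2 a h h' =>
    have ha : (6 : ℝ) ≤ a := by exact_mod_cast h'
    refine ⟨1 - 8 / (2 * a + 1), 1 - 4 / (2 * a + 1), ?_⟩
    simp only [orbit_cons_eq, orbit_nil_iff]
    push_cast
    refine ⟨⟨?_, ?_, ?_, ?_, ?_⟩, ⟨?_, ?_, ?_, ?_, ?_⟩, ⟨?_, ?_, ?_, ?_, ?_⟩,
      ?_, ?_, ?_, ?_, ?_⟩ <;> field_simp <;> linarith
  | row4_1 a h h' =>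
    have ha : (7 : ℝ) ≤ a := by exact_mod_cast h'
    refine ⟨1 - 2 / a, 1, ?_⟩
    simp only [orbit_cons_eq, orbit_nil_iff]
    push_cast
    refine ⟨⟨?_, ?_, ?_, ?_, ?_⟩, ⟨?_, ?_, ?_, ?_, ?_⟩, ⟨?_, ?_, ?_, ?_, ?_⟩,
      ⟨?_, ?_, ?_, ?_, ?_⟩, ?_, ?_, ?_, ?_, ?_⟩ <;> field_simp <;> linarith
  | row4_2 a h h' =>
    have ha : (7 : ℝ) ≤ a := by exact_mod_cast h'
    refine ⟨1 - 4 / a, 1 - 2 / a, ?_⟩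
    simp only [orbit_cons_eq, orbit_nil_iff]
    push_cast
    refine ⟨⟨?_, ?_, ?_, ?_, ?_⟩, ⟨?_, ?_, ?_, ?_, ?_⟩, ⟨?_, ?_, ?_, ?_, ?_⟩,
      ⟨?_, ?_, ?_, ?_, ?_⟩, ?_, ?_, ?_, ?_, ?_⟩ <;> field_simp <;> linarith
  | row5_1 a h h' =>
    have ha : (8 : ℝ) ≤ a := by exact_mod_cast h'
    refine ⟨1 - 4 / a, 1 - 2 / a, ?_⟩
    simp only [orbit_cons_eq, orbit_nil_iff]
    push_cast
    refine ⟨⟨?_, ?_, ?_, ?_, ?_⟩, ⟨?_, ?_, ?_, ?_, ?_⟩, ⟨?_, ?_, ?_, ?_, ?_⟩,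
      ⟨?_, ?_, ?_, ?_, ?_⟩, ⟨?_, ?_, ?_, ?_, ?_⟩, ?_, ?_, ?_, ?_, ?_⟩ <;> field_simp <;> linarith
  | row5_2 a h h' => exact admissible_one_replicate_two_three (n := 2) le_rfl h h'
  | row6 _ a hr h h' =>
    simpa using admissible_one_replicate_two_three (k := a) (n := r - 3) (by omega) (by omega)
      (by omega)
  | row2_2 => exact ⟨1, 1, by norm_num [Orbit, fareyTriangle]⟩
  | row2_3 => exact ⟨3/4, 1/2, by norm_num [Orbit, fareyTriangle]⟩
  | row2_4 => exact ⟨1, 3/7, by norm_num [Orbit, fareyTriangle]⟩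
  | row3_3a => exact ⟨2/5, 1, by norm_num [Orbit, fareyTriangle]⟩
  | row3_3b => exact ⟨1, 4/5, by norm_num [Orbit, fareyTriangle]⟩
  | row3_4 => exact ⟨1, 3/4, by norm_num [Orbit, fareyTriangle]⟩
  | row3_5 => exact ⟨1, 2/3, by norm_num [Orbit, fareyTriangle]⟩
  | row3_6 a h h' =>
    interval_cases a
    exacts [⟨5/7, 3/7, by norm_num [Orbit, fareyTriangle]⟩,
      ⟨1, 2/5, by norm_num [Orbit, fareyTriangle]⟩,
      ⟨1, 1/3, by norm_num [Orbit, fareyTriangle]⟩,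
      ⟨7/8, 1/4, by norm_num [Orbit, fareyTriangle]⟩,
      ⟨1, 3/13, by norm_num [Orbit, fareyTriangle]⟩]
  | row4_3a => exact ⟨1/3, 7/9, by norm_num [Orbit, fareyTriangle]⟩
  | row4_3b => exact ⟨2/3, 5/9, by norm_num [Orbit, fareyTriangle]⟩
  | row4_4a => exact ⟨1/2, 1, by norm_num [Orbit, fareyTriangle]⟩
  | row4_4b => exact ⟨1, 1/2, by norm_num [Orbit, fareyTriangle]⟩
  | row4_5a => exact ⟨5/9, 1, by norm_num [Orbit, fareyTriangle]⟩
  | row4_5b => exact ⟨8/9, 1/3, by norm_num [Orbit, fareyTriangle]⟩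
  | row4_6a => exact ⟨1, 5/7, by norm_num [Orbit, fareyTriangle]⟩
  | row4_6b => exact ⟨5/7, 4/7, by norm_num [Orbit, fareyTriangle]⟩
  | row4_7a => exact ⟨5/8, 7/8, by norm_num [Orbit, fareyTriangle]⟩
  | row4_7b => exact ⟨1, 5/8, by norm_num [Orbit, fareyTriangle]⟩
  | row4_8a => exact ⟨1, 9/13, by norm_num [Orbit, fareyTriangle]⟩
  | row4_8b => exact ⟨1, 6/13, by norm_num [Orbit, fareyTriangle]⟩
  | row4_9 a h h' =>
    interval_cases a
    exacts [⟨10/11, 3/11, by norm_num [Orbit, fareyTriangle]⟩,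
      ⟨1, 1/4, by norm_num [Orbit, fareyTriangle]⟩,
      ⟨1, 2/9, by norm_num [Orbit, fareyTriangle]⟩,
      ⟨1, 1/5, by norm_num [Orbit, fareyTriangle]⟩,
      ⟨11/12, 1/6, by norm_num [Orbit, fareyTriangle]⟩,
      ⟨1, 3/19, by norm_num [Orbit, fareyTriangle]⟩]
  | row5_3 a h h' =>
    interval_cases a
    exacts [⟨4/5, 3/10, by norm_num [Orbit, fareyTriangle]⟩,
      ⟨1, 2/7, by norm_num [Orbit, fareyTriangle]⟩,
      ⟨1, 4/17, by norm_num [Orbit, fareyTriangle]⟩]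
  | row5_4 a h h' =>
    interval_cases a
    exacts [⟨1/2, 9/10, by norm_num [Orbit, fareyTriangle]⟩,
      ⟨4/7, 1, by norm_num [Orbit, fareyTriangle]⟩,
      ⟨10/17, 1, by norm_num [Orbit, fareyTriangle]⟩]
  | row5_5 => exact ⟨4/5, 3/5, by norm_num [Orbit, fareyTriangle]⟩
  | row5_6a => exact ⟨7/13, 10/13, by norm_num [Orbit, fareyTriangle]⟩
  | row5_6b => exact ⟨1, 8/13, by norm_num [Orbit, fareyTriangle]⟩
  | row5_7a => exact ⟨7/9, 5/9, by norm_num [Orbit, fareyTriangle]⟩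
  | row5_7b => exact ⟨1, 4/9, by norm_num [Orbit, fareyTriangle]⟩

/-! ### Residues and continuants of the rows -/

theorem TupleTable.exists_cons {r : ℕ} {k : List ℕ} {v : ℤ} (h : TupleTable r k v) :
    (∀ a ∈ k, 1 ≤ a) ∧ ∃ a l, k = a :: l ∧ l.length + 1 = r ∧ FirstHit 1 0 l := by
  cases h with
  | row6 _ a hr h h' =>
    obtain ⟨n, rfl⟩ := Nat.exists_eq_add_of_le' hr
    refine ⟨?_, a, _, rfl, by simp, by norm_num, firstHit_replicate_two_three _⟩
    intro b hb
    simp only [List.mem_append, List.mem_cons, List.mem_replicate, List.not_mem_nil,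
      or_false] at hb
    omega
  | _ =>
    try simp only [Nat.ModEq] at *
    refine ⟨?_, _, _, rfl, rfl, ?_⟩
    · simp
      try omega
    · simp [FirstHit]
      try omega

theorem continuant_replicate_two_three : ∀ n : ℕ,
    continuant (List.replicate n 2 ++ [3]) = 2 * n + 3
  | 0 => rfl
  | 1 => rfl
  | n + 2 => by
    have h1 := continuant_replicate_two_three (n + 1)
    have h2 := continuant_replicate_two_three n
    simp only [List.replicate_succ, List.cons_append, continuant] at h1 ⊢
    rw [h1, h2]
    push_cast
    ring

theorem TupleTable.continuant_eq {r : ℕ} {k : List ℕ} {v : ℤ} (h : TupleTable r k v) :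
    continuant k = v := by
  cases h with
  | row6 _ a hr h h' =>
    obtain ⟨n, rfl⟩ := Nat.exists_eq_add_of_le' hr
    -- Consecutive values 2m + 3 differ by 2, so the tail (1, 2, …, 2, 3) has continuant 2, the
    -- coefficient of a.
    have h1 := continuant_replicate_two_three (n + 3)
    have h2 := continuant_replicate_two_three (n + 2)
    have e : n + 6 - 3 = n + 3 := by omega
    rw [List.replicate_succ] at h1
    simp only [e, List.replicate_succ, List.cons_append, List.nil_append, continuant] at h1 h2 ⊢
    rw [h1, h2]
    push_cast
    ring
  | _ =>
    simp only [continuant]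
    push_cast
    try ring

theorem lemma14 (r : ℕ) (hr : 1 ≤ r) :
    tupleSet r 3 1 0 = tupleSet r 3 2 0 ∧
      (∀ k : List ℕ, k ∈ tupleSet r 3 1 0 ↔ ∃ v : ℤ, TupleTable r k v) ∧
      (∀ (k : List ℕ) (v : ℤ), TupleTable r k v → continuant k = v) := by
  refine ⟨?_, fun k => ⟨fun h => ?_, fun ⟨v, h⟩ => ?_⟩, fun k v h => h.continuant_eq⟩
  · ext k
    rw [mem_tupleSet_iff (by norm_num), mem_tupleSet_iff (by norm_num)]
  · cases k with
    | nil =>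
      have := h.1
      simp at this
      omega
    | cons a l =>
      obtain ⟨rfl, hpos, hl, h⟩ := cons_mem_tupleSet_iff.1 h
      exact exists_tupleTable h hpos hl
  · obtain ⟨hpos, a, l, rfl, hlen, hl⟩ := h.exists_cons
    exact cons_mem_tupleSet_iff.2 ⟨hlen, hpos, hl, h.admissible⟩
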